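/- Let $K$ be a commutative unital ring, $G$ a group, and let $\mathcal A=\prod_{\lambda\in\Lambda}\mathcal A_\lambda$ be a direct product (over an arbitrary index set) of unital, not necessarily commutative, $K$-algebras $\mathcal A_\lambda$, each of which is indecomposable as a ring, i.e. nonzero and without central idempotents other than $0$ and $1$ (for $K=\mathbb Z$ these are arbitrary indecomposable unital rings). Let $\alpha=\{\alpha_g:\mathcal D_{g^{-1}}\to\mathcal D_g\mid g\in G\}$ be a (not necessarily transitive) unital partial action of $G$ on $\mathcal A$: each $\mathcal D_g=1_g\mathcal A$ for a central idempotent $1_g$ of $\mathcal A$, each $\alpha_g$ is an isomorphism of $K$-algebras, $\alpha_1=\mathrm{id}_{\mathcal A}$, and whenever $a\in\mathcal D_{h^{-1}}$ and $\alpha_h(a)\in\mathcal D_{g^{-1}}$, one has $a\in\mathcal D_{(gh)^{-1}}$ and $\alpha_g(\alpha_h(a))=\alpha_{gh}(a)$. Let $K_{par}G$ be the partial group algebra, i.e. the $K$-algebra of the monoid with generators $[g]$ ($g\in G$), identity $[1]$, and relations $[g^{-1}][g][h]=[g^{-1}][gh]$, $[g][h][h^{-1}]=[gh][h^{-1}]$,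 $[g][1]=[g]$. Then $\mathcal A$ is a $K_{par}G$-module via $[g]\cdot a=\alpha_g(1_{g^{-1}}a)$. With $e_g=[g][g^{-1}]$ and $e_{(g_1,\dots,g_n)}=e_{g_1}e_{g_1g_2}\cdots e_{g_1\cdots g_n}$ (equal to $1$ for $n=0$), let $Z^n_{par}(G,\mathcal A)$, $n\ge 0$, be the group of maps $w:G^n\to\mathcal A$ (elements $w\in\mathcal A$ if $n=0$) such that $w(g_1,\dots,g_n)\in e_{(g_1,\dots,g_n)}\cdot\mathcal A$ and $$[g_1]\cdot w(g_2,\dots,g_{n+1})+\sum_{i=1}^n(-1)^ie_{g_1\cdots g_i}\cdot w(g_1,\dots,g_ig_{i+1},\dots,g_{n+1})+(-1)^{n+1}e_{g_1\cdots g_{n+1}}\cdot w(g_1,\dots,g_n)=0$$ for all $g_1,\dots,g_{n+1}\in G$. Let $(\mathcal B,\beta)$ be an enveloping action of $(\mathcal A,\alpha)$: $\beta$ is an action of $G$ by automorphisms on a not necessarily unital $K$-algebra $\mathcal B$, and $\varphi:\mathcal A\to\mathcal B$ is an injective homomorphism of $K$-algebras such that $\varphi(\mathcal A)$ is a two-sided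 ideal of $\mathcal B$, $\varphi(\mathcal D_g)=\varphi(\mathcal A)\cap\beta_g(\varphi(\mathcal A))$, $\varphi\circ\alpha_g=\beta_g\circ\varphi$ on $\mathcal D_{g^{-1}}$ for all $g\in G$, and $\mathcal B=\sum_{g\in G}\beta_g(\varphi(\mathcal A))$. Let $\mathcal M(\mathcal B)$ be the multiplier algebra of $\mathcal B$, consisting of the pairs $u=(R,L)$ of a left $\mathcal B$-module endomorphism $R$ (written on the right) and a right $\mathcal B$-module endomorphism $L$ of $\mathcal B$, both $K$-linear, with $(aR)b=a(Lb)$ for all $a,b\in\mathcal B$; put $bu=bR$, $ub=Lb$. The group $G$ acts on $\mathcal M(\mathcal B)$ by $\beta^*_g(u)=\beta_gu\beta_g^{-1}$, and $Z^n(G,\mathcal M(\mathcal B))$ denotes the group of usual $n$-cocycles of $G$ with values in the additive group of $\mathcal M(\mathcal B)$ with this action. Then for every $n\ge 0$ each $w\in Z^n_{par}(G,\mathcal A)$ is globalizable: there exists $u\in Z^n(G,\mathcal M(\mathcal B))$ such that $$\varphi(w(g_1,\dots,g_n))=\varphi(1_{(g_1,\dots,g_n)})\,u(g_1,\dots,g_n)\qquad\text{for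 all }g_1,\dots,g_n\in G,$$ where $1_{(g_1,\dots,g_n)}=1_{g_1}1_{g_1g_2}\cdots1_{g_1\cdots g_n}$ (equal to $1_{\mathcal A}$ for $n=0$). -/

import Mathlib

universe u v

/-! ### The partial group algebra -/

/-- The defining relations of Exel's monoid `S(G)` on the generators `[g]`, `g ∈ G`; the
identity of the monoid is `[1]`. -/
inductive ExelRel (G : Type*) [Group G] : FreeMonoid G → FreeMonoid G → Prop
  | inv_mul (g h : G) : ExelRel G
      (FreeMonoid.of g⁻¹ * FreeMonoid.of g * FreeMonoid.of h)
      (FreeMonoid.of g⁻¹ * FreeMonoid.of (g * h))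
  | mul_inv (g h : G) : ExelRel G
      (FreeMonoid.of g * FreeMonoid.of h * FreeMonoid.of h⁻¹)
      (FreeMonoid.of (g * h) * FreeMonoid.of h⁻¹)
  | mul_one (g : G) : ExelRel G (FreeMonoid.of g * FreeMonoid.of 1) (FreeMonoid.of g)
  | one : ExelRel G (FreeMonoid.of 1) 1

/-- Exel's monoid `S(G)`. -/
abbrev ExelMonoid (G : Type*) [Group G] : Type _ := PresentedMonoid (ExelRel G)

/-- The partial group algebra `K_par G`, the monoid algebra of `S(G)` over `K`. -/
abbrev ParGroupAlgebra (K G : Type*) [CommRing K] [Group G] : Type _ :=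
  MonoidAlgebra K (ExelMonoid G)

namespace ParGroupAlgebra

/-- The element `[g]` of `K_par G`. -/
noncomputable def bracket (K : Type*) {G : Type*} [CommRing K] [Group G] (g : G) :
    ParGroupAlgebra K G :=
  MonoidAlgebra.of K (ExelMonoid G) (PresentedMonoid.of (ExelRel G) g)

/-- The idempotent `e_g = [g][g⁻¹]` of `K_par G`. -/
noncomputable def e (K : Type*) {G : Type*} [CommRing K] [Group G] (g : G) :
    ParGroupAlgebra K G :=
  bracket K g * bracket K g⁻¹

/-- `e_{(g₁,…,gₙ)} = e_{g₁} e_{g₁g₂} ⋯ e_{g₁⋯gₙ}`, which is `1` for `n = 0`. -/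
noncomputable def eTuple (K : Type*) {G : Type*} [CommRing K] [Group G] {n : ℕ} (g : Fin n → G) :
    ParGroupAlgebra K G :=
  (List.ofFn fun i : Fin n => e K (Fin.partialProd g i.succ)).prod

end ParGroupAlgebra

/-- A partial representation of a group `G` in a monoid `S`. -/
structure PartialRep (G S : Type*) [Group G] [Monoid S] where
  toFun : G → S
  map_one : toFun 1 = 1
  inv_mul : ∀ g h : G, toFun g⁻¹ * toFun g * toFun h = toFun g⁻¹ * toFun (g * h)
  mul_inv : ∀ g h : G, toFun g * toFun h * toFun h⁻¹ = toFun (g * h) * toFun h⁻¹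

/-- The monoid homomorphism `S(G) → S` corresponding to a partial representation. -/
def PartialRep.lift {G S : Type*} [Group G] [Monoid S] (π : PartialRep G S) :
    ExelMonoid G →* S :=
  PresentedMonoid.lift π.toFun (by
    intro a b h
    cases h with
    | inv_mul g h => simpa using π.inv_mul g h
    | mul_inv g h => simpa using π.mul_inv g h
    | mul_one g => simp [π.map_one]
    | one => simp [π.map_one])

/-! ### Partial cohomology with values in a `K_par G`-module

A `K_par G`-module `M` is given by its structure map `ρ : K_par G → End_K(M)`. -/

section ParCochains

variable {K G M : Type*} [CommRing K] [Group G] [AddCommGroup M] [Module K M]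

/-- The group `Cⁿ_par(G, M)` of all `f : Gⁿ → M` with `f(g₁,…,gₙ) ∈ e_{(g₁,…,gₙ)} · M`. -/
noncomputable def parCochains (ρ : ParGroupAlgebra K G →ₐ[K] Module.End K M) (n : ℕ) :
    AddSubgroup ((Fin n → G) → M) where
  carrier := {f | ∀ g, ∃ m : M, f g = ρ (ParGroupAlgebra.eTuple K g) m}
  zero_mem' := fun g => ⟨0, by simp⟩
  add_mem' := by
    intro f f' hf hf' g
    obtain ⟨m, hm⟩ := hf g
    obtain ⟨m', hm'⟩ := hf' g
    exact ⟨m + m', by simp [hm, hm']⟩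
  neg_mem' := by
    intro f hf g
    obtain ⟨m, hm⟩ := hf g
    exact ⟨-m, by simp [hm]⟩

/-- The coboundary formula
`(δⁿf)(g₁,…,gₙ₊₁) = [g₁]·f(g₂,…,gₙ₊₁) + ∑_{j=1}^{n} (-1)^j e_{g₁⋯gⱼ}·f(g₁,…,gⱼgⱼ₊₁,…,gₙ₊₁)
  + (-1)^{n+1} e_{g₁⋯gₙ₊₁}·f(g₁,…,gₙ)`.
The last summand is the term `j = Fin.last n` of the sum below. -/
noncomputable def parCoboundary (ρ : ParGroupAlgebra K G →ₐ[K] Module.End K M) (n : ℕ) :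
    ((Fin n → G) → M) →+ ((Fin (n + 1) → G) → M) where
  toFun f g := ρ (ParGroupAlgebra.bracket K (g 0)) (f fun i => g i.succ) +
    ∑ j : Fin (n + 1), (-1 : ℤ) ^ ((j : ℕ) + 1) •
      ρ (ParGroupAlgebra.e K (Fin.partialProd g j.succ)) (f (Fin.contractNth j (· * ·) g))
  map_zero' := by
    ext g
    simp
  map_add' f f' := by
    ext g
    simp [Finset.sum_add_distrib, add_add_add_comm]

/-- The group `Zⁿ_par(G, M)` of `n`-cocycles. -/
noncomputable def parCocycles (ρ : ParGroupAlgebra K G →ₐ[K] Module.End K M) (n : ℕ) :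
    AddSubgroup ((Fin n → G) → M) :=
  parCochains ρ n ⊓ (parCoboundary ρ n).ker

end ParCochains

/-! ### Usual group cohomology -/

section Cochains

variable {K G M : Type*} [CommRing K] [Group G] [AddCommGroup M] [Module K M]

/-- The usual coboundary `Cⁿ(G, M) → Cⁿ⁺¹(G, M)` on inhomogeneous cochains,
`(δⁿf)(g₁,…,gₙ₊₁) = g₁·f(g₂,…,gₙ₊₁) + ∑_{j=1}^{n} (-1)^j f(g₁,…,gⱼgⱼ₊₁,…,gₙ₊₁)
  + (-1)^{n+1} f(g₁,…,gₙ)`. -/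
def usualCoboundary (ρ : Representation K G M) (n : ℕ) :
    ((Fin n → G) → M) →+ ((Fin (n + 1) → G) → M) where
  toFun f g := ρ (g 0) (f fun i => g i.succ) +
    ∑ j : Fin (n + 1), (-1 : ℤ) ^ ((j : ℕ) + 1) • f (Fin.contractNth j (· * ·) g)
  map_zero' := by
    ext g
    simp
  map_add' f f' := by
    ext g
    simp [Finset.sum_add_distrib, add_add_add_comm]

/-- The group `Zⁿ(G, M)` of usual `n`-cocycles. -/
def usualCocycles (ρ : Representation K G M) (n : ℕ) : AddSubgroup ((Fin n → G) → M) :=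
  (usualCoboundary ρ n).ker

end Cochains

/-- For `K` and `G` in one universe, `usualCoboundary` is the differential of Mathlib's complex
of inhomogeneous cochains. -/
theorem usualCoboundary_eq_inhomogeneousCochains_d {K G : Type u} {M : Type v} [CommRing K]
    [Group G] [AddCommGroup M] [Module K M] (ρ : Representation K G M) (n : ℕ)
    (f : (Fin n → G) → M) :
    usualCoboundary ρ n f = (inhomogeneousCochains.d (Rep.of ρ) n).hom f := by
  ext g
  simp only [usualCoboundary, AddMonoidHom.coe_mk, ZeroHom.coe_mk,
    inhomogeneousCochains.d_hom_apply]
  congr 1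
  refine Finset.sum_congr rfl fun j _ => ?_
  rcases neg_one_pow_eq_or ℤ ((j : ℕ) + 1) with h | h <;>
  rcases Nat.even_or_odd ((j : ℕ) + 1) with h' | h' <;> simp [h'.neg_one_pow]

/-! ### Partial actions -/

/-- A partial action of a group `G` on a (not necessarily unital) `K`-algebra `A`: two-sided
ideals `D_g` of `A` and algebra isomorphisms `α_g : D_{g⁻¹} → D_g` such that `α_1 = id_A`, and
such that whenever `α_h(a)` and `α_g(α_h(a))` exist, so does `α_{gh}(a)`, with
`α_g(α_h(a)) = α_{gh}(a)`. -/
structure PartialAction (K G A : Type*) [CommRing K] [Group G] [NonUnitalRing A] [Module K A]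
    [IsScalarTower K A A] [SMulCommClass K A A] where
  domain : G → Submodule K A
  mul_mem_left : ∀ (g : G) (x : A) {a : A}, a ∈ domain g → x * a ∈ domain g
  mul_mem_right : ∀ (g : G) (x : A) {a : A}, a ∈ domain g → a * x ∈ domain g
  act : (g : G) → domain g⁻¹ ≃ₗ[K] domain g
  act_mul : ∀ (g : G) (a b : domain g⁻¹),
    (act g ⟨(a : A) * b, mul_mem_left g⁻¹ a b.2⟩ : A) = (act g a : A) * act g b
  act_one : ∀ a : A, ∃ ha : a ∈ domain 1⁻¹, (act 1 ⟨a, ha⟩ : A) = a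
  act_act : ∀ (g h : G) (a : A) (ha : a ∈ domain h⁻¹) (hb : (act h ⟨a, ha⟩ : A) ∈ domain g⁻¹),
    ∃ hc : a ∈ domain (g * h)⁻¹, (act g ⟨act h ⟨a, ha⟩, hb⟩ : A) = act (g * h) ⟨a, hc⟩

/-- A unital partial action on a unital algebra: `D_g = 1_g A` for a central idempotent `1_g`
(which is determined by `D_g`). -/
structure UnitalPartialAction (K G A : Type*) [CommRing K] [Group G] [Ring A] [Algebra K A]
    extends PartialAction K G A where
  unit : G → A
  unit_idem : ∀ g, IsIdempotentElem (unit g)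
  unit_central : ∀ g a, Commute (unit g) a
  mem_domain_iff : ∀ g a, a ∈ domain g ↔ ∃ x, a = unit g * x

namespace UnitalPartialAction

variable {K G A : Type*} [CommRing K] [Group G] [Ring A] [Algebra K A]
  (α : UnitalPartialAction K G A)

theorem unit_mul_mem (g : G) (a : A) : α.unit g * a ∈ α.domain g :=
  (α.mem_domain_iff g _).2 ⟨a, rfl⟩

theorem unit_mul_of_mem {g : G} {a : A} (ha : a ∈ α.domain g) : α.unit g * a = a := by
  obtain ⟨x, rfl⟩ := (α.mem_domain_iff g a).1 ha
  rw [← mul_assoc, (α.unit_idem g).eq]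

/-- The `K`-linear map `π_g(a) = α_g(1_{g⁻¹} a)` from `A` to `A`. -/
def piMap (g : G) : Module.End K A where
  toFun a := (α.act g ⟨α.unit g⁻¹ * a, α.unit_mul_mem g⁻¹ a⟩ : A)
  map_add' a b := by
    rw [← Submodule.coe_add, ← map_add]
    simp [mul_add]
  map_smul' k a := by
    rw [RingHom.id_apply, ← Submodule.coe_smul, ← map_smul]
    simp

theorem piMap_apply (g : G) (a : A) :
    α.piMap g a = (α.act g ⟨α.unit g⁻¹ * a, α.unit_mul_mem g⁻¹ a⟩ : A) := rfl

theorem piMap_of_mem {g : G} {a : A} (ha : a ∈ α.domain g⁻¹) :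
    α.piMap g a = (α.act g ⟨a, ha⟩ : A) := by
  simp only [piMap_apply, α.unit_mul_of_mem ha]

theorem piMap_mem (g : G) (a : A) : α.piMap g a ∈ α.domain g :=
  (α.act g _).2

theorem piMap_unit_mul (g : G) (a : A) : α.piMap g (α.unit g⁻¹ * a) = α.piMap g a := by
  rw [α.piMap_of_mem (α.unit_mul_mem g⁻¹ a), piMap_apply]

theorem piMap_mul (g : G) (a b : A) : α.piMap g (a * b) = α.piMap g a * α.piMap g b := by
  simp only [piMap_apply]
  rw [← α.act_mul]
  congr 3
  change α.unit g⁻¹ * (a * b) = α.unit g⁻¹ * a * (α.unit g⁻¹ * b)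
  rw [mul_assoc, ← mul_assoc a, ← (α.unit_central g⁻¹ a).eq, mul_assoc (α.unit g⁻¹) a b,
    ← mul_assoc (α.unit g⁻¹) (α.unit g⁻¹), (α.unit_idem g⁻¹).eq]

theorem piMap_one (a : A) : α.piMap 1 a = a := by
  obtain ⟨ha, h⟩ := α.act_one a
  rw [α.piMap_of_mem ha, h]

theorem piMap_comp {g h : G} {a : A} (ha : a ∈ α.domain h⁻¹) (hb : α.piMap h a ∈ α.domain g⁻¹) :
    a ∈ α.domain (g * h)⁻¹ ∧ α.piMap g (α.piMap h a) = α.piMap (g * h) a := by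
  have hb' := hb
  rw [α.piMap_of_mem ha] at hb'
  obtain ⟨hc, e⟩ := α.act_act g h a ha hb'
  refine ⟨hc, ?_⟩
  rw [α.piMap_of_mem hc, ← e, α.piMap_of_mem hb]
  congr 3
  exact α.piMap_of_mem ha

theorem piMap_piMap_inv {g : G} {a : A} (ha : a ∈ α.domain g) :
    α.piMap g (α.piMap g⁻¹ a) = a := by
  have ha' : a ∈ α.domain g⁻¹⁻¹ := by rwa [inv_inv]
  rw [(α.piMap_comp ha' (α.piMap_mem g⁻¹ a)).2, mul_inv_cancel, α.piMap_one]

/-- `α_g(D_{g⁻¹} ∩ D_h) ⊆ D_{gh}`. -/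
theorem piMap_mem_mul {g h : G} {a : A} (ha : a ∈ α.domain g⁻¹) (hb : a ∈ α.domain h) :
    α.piMap g a ∈ α.domain (g * h) := by
  have h1 := α.piMap_piMap_inv hb
  rw [← h1] at ha
  have h2 := (α.piMap_comp (α.piMap_mem h⁻¹ a) ha).2
  rw [h1] at h2
  rw [h2]
  exact α.piMap_mem _ _

theorem piMap_unit (g h : G) : α.piMap g (α.unit h) = α.unit g * α.unit (g * h) := by
  have hc : α.unit g * α.unit (g * h) ∈ α.domain g := α.unit_mul_mem _ _
  have hd : α.unit g * α.unit (g * h) ∈ α.domain (g * h) := by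
    rw [(α.unit_central g _).eq]
    exact α.unit_mul_mem _ _
  have hq : α.piMap g⁻¹ (α.unit g * α.unit (g * h)) ∈ α.domain h := by
    have := α.piMap_mem_mul (g := g⁻¹) (by rwa [inv_inv]) hd
    rwa [inv_mul_cancel_left] at this
  have h1 : α.piMap g (α.unit h) * (α.unit g * α.unit (g * h)) = α.unit g * α.unit (g * h) := by
    conv_lhs => rw [← α.piMap_piMap_inv hc]
    rw [← α.piMap_mul, α.unit_mul_of_mem hq, α.piMap_piMap_inv hc]
  have h2 : α.piMap g (α.unit h) ∈ α.domain (g * h) := by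
    rw [← α.piMap_unit_mul]
    refine α.piMap_mem_mul (α.unit_mul_mem _ _) ?_
    rw [(α.unit_central g⁻¹ _).eq]
    exact α.unit_mul_mem _ _
  rw [← h1, ← mul_assoc, ← (α.unit_central g _).eq, α.unit_mul_of_mem (α.piMap_mem _ _),
    ← (α.unit_central (g * h) _).eq, α.unit_mul_of_mem h2]

theorem piMap_piMap (g h : G) (a : A) :
    α.piMap g (α.piMap h a) = α.unit g * α.piMap (g * h) a := by
  have hz : α.unit h⁻¹ * (α.unit (g * h)⁻¹ * a) ∈ α.domain h⁻¹ := α.unit_mul_mem _ _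
  have h1 : α.piMap h (α.unit h⁻¹ * (α.unit (g * h)⁻¹ * a)) = α.unit g⁻¹ * α.piMap h a := by
    rw [α.piMap_unit_mul, α.piMap_mul, α.piMap_unit, mul_inv_rev, mul_inv_cancel_left,
      mul_assoc, ← mul_assoc, (α.unit_central h _).eq, mul_assoc,
      α.unit_mul_of_mem (α.piMap_mem _ _)]
  have h2 := (α.piMap_comp (g := g) hz (by rw [h1]; exact α.unit_mul_mem _ _)).2
  rw [h1, α.piMap_unit_mul] at h2
  rw [h2, α.piMap_mul, α.piMap_unit_mul, α.piMap_unit, mul_inv_cancel_right,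
    (α.unit_central (g * h) _).eq, mul_assoc, α.unit_mul_of_mem (α.piMap_mem _ _)]

/-- The partial representation `g ↦ π_g` of `G` in `End_K(A)`. -/
def partialRep : PartialRep G (Module.End K A) where
  toFun := α.piMap
  map_one := by
    ext a
    exact α.piMap_one a
  inv_mul g h := by
    ext a
    simp only [Module.End.mul_apply]
    rw [α.piMap_piMap g h]
    conv_lhs => rw [← inv_inv g]
    rw [inv_inv g⁻¹, α.piMap_unit_mul, inv_inv]
  mul_inv g h := by
    ext a
    simp only [Module.End.mul_apply]
    rw [α.piMap_piMap g h, α.unit_mul_of_mem]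
    rw [α.piMap_piMap, mul_inv_cancel_right]
    exact α.mul_mem_left g _ (α.piMap_mem g a)

/-- The `K_par G`-module structure on `A` induced by a unital partial action:
`[g] · a = α_g(1_{g⁻¹} a)`. -/
noncomputable def inducedModule : ParGroupAlgebra K G →ₐ[K] Module.End K A :=
  MonoidAlgebra.lift K _ _ α.partialRep.lift

theorem inducedModule_bracket (g : G) (a : A) :
    α.inducedModule (ParGroupAlgebra.bracket K g) a = α.piMap g a := by
  simp [inducedModule, ParGroupAlgebra.bracket, PartialRep.lift, partialRep]

theorem inducedModule_e (g : G) (a : A) :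
    α.inducedModule (ParGroupAlgebra.e K g) a = α.unit g * a := by
  rw [ParGroupAlgebra.e, map_mul, Module.End.mul_apply, inducedModule_bracket,
    inducedModule_bracket, piMap_piMap, mul_inv_cancel, piMap_one]

/-- `1_{(g₁,…,gₙ)} = 1_{g₁} 1_{g₁g₂} ⋯ 1_{g₁⋯gₙ}`, which is `1_A` for `n = 0`. -/
def unitTuple {n : ℕ} (g : Fin n → G) : A :=
  (List.ofFn fun i : Fin n => α.unit (Fin.partialProd g i.succ)).prod

end UnitalPartialAction

/-! ### Global actions, multipliers and enveloping actions -/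

/-- A (global) action of `G` on a not necessarily unital `K`-algebra `B` by algebra
automorphisms. -/
structure GlobalAction (K G B : Type*) [CommRing K] [Group G] [NonUnitalRing B] [Module K B]
    [IsScalarTower K B B] [SMulCommClass K B B] where
  β : G →* (B ≃ₗ[K] B)
  β_mul : ∀ g (a b : B), β g (a * b) = β g a * β g b

/-- The multiplier algebra `M(B)`: the pairs `(R, L)` of a left `B`-module endomorphism `R` and a
right `B`-module endomorphism `L` of `B` with `(aR)b = a(Lb)`. As `R` is written on the right of
its argument, it is an element of the opposite of `End_K(B)`. -/
def MultiplierAlgebra (K B : Type*) [CommRing K] [NonUnitalRing B] [Module K B]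
    [IsScalarTower K B B] [SMulCommClass K B B] :
    Subalgebra K ((Module.End K B)ᵐᵒᵖ × Module.End K B) where
  carrier := {u | (∀ a b, u.1.unop (a * b) = a * u.1.unop b) ∧
    (∀ a b, u.2 (a * b) = u.2 a * b) ∧ ∀ a b, u.1.unop a * b = a * u.2 b}
  mul_mem' := by
    rintro u v ⟨h1, h2, h3⟩ ⟨k1, k2, k3⟩
    refine ⟨fun a b => ?_, fun a b => ?_, fun a b => ?_⟩
    · simp [h1, k1]
    · simp [h2, k2]
    · simp [h3, k3]
  add_mem' := by
    rintro u v ⟨h1, h2, h3⟩ ⟨k1, k2, k3⟩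
    refine ⟨fun a b => ?_, fun a b => ?_, fun a b => ?_⟩
    · simp [h1, k1, mul_add]
    · simp [h2, k2, add_mul]
    · simp [h3, k3, mul_add, add_mul]
  algebraMap_mem' := by
    intro k
    refine ⟨fun a b => ?_, fun a b => ?_, fun a b => ?_⟩ <;>
    simp [Module.algebraMap_end_apply, mul_smul_comm, smul_mul_assoc]

namespace MultiplierAlgebra

variable {K B : Type*} [CommRing K] [NonUnitalRing B] [Module K B]
    [IsScalarTower K B B] [SMulCommClass K B B]

/-- `b u = bR` for `u = (R, L)`. -/
def rightMul (b : B) (u : MultiplierAlgebra K B) : B := u.1.1.unop b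

/-- `u b = Lb` for `u = (R, L)`. -/
def leftMul (u : MultiplierAlgebra K B) (b : B) : B := u.1.2 b

end MultiplierAlgebra

namespace GlobalAction

variable {K G B : Type*} [CommRing K] [Group G] [NonUnitalRing B] [Module K B]
    [IsScalarTower K B B] [SMulCommClass K B B] (E : GlobalAction K G B)

theorem symm_mul (g : G) (a b : B) :
    (E.β g).symm (a * b) = (E.β g).symm a * (E.β g).symm b := by
  rw [LinearEquiv.symm_apply_eq, E.β_mul, LinearEquiv.apply_symm_apply,
    LinearEquiv.apply_symm_apply]

theorem conj_mem (g : G) (u : MultiplierAlgebra K B) :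
    (MulOpposite.op ((E.β g).conj u.1.1.unop), (E.β g).conj u.1.2) ∈ MultiplierAlgebra K B := by
  have h1 := u.2.1
  have h2 := u.2.2.1
  have h3 := u.2.2.2
  refine ⟨fun a b => ?_, fun a b => ?_, fun a b => ?_⟩
  · simp only [MulOpposite.unop_op, LinearEquiv.conj_apply_apply, symm_mul]
    rw [h1, E.β_mul, LinearEquiv.apply_symm_apply]
  · simp only [LinearEquiv.conj_apply_apply, symm_mul]
    rw [h2, E.β_mul, LinearEquiv.apply_symm_apply]
  · simp only [MulOpposite.unop_op, LinearEquiv.conj_apply_apply]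
    have := congrArg (E.β g) (h3 ((E.β g).symm a) ((E.β g).symm b))
    simpa only [E.β_mul, LinearEquiv.apply_symm_apply] using this

/-- The linear map `u ↦ β_g u β_g⁻¹` on the multiplier algebra. -/
def conjMap (g : G) : MultiplierAlgebra K B →ₗ[K] MultiplierAlgebra K B where
  toFun u := ⟨(MulOpposite.op ((E.β g).conj u.1.1.unop), (E.β g).conj u.1.2), E.conj_mem g u⟩
  map_add' u v := by
    apply Subtype.ext
    simp
  map_smul' k u := by
    apply Subtype.ext
    simp

/-- The induced action `β*_g(u) = β_g u β_g⁻¹` of `G` on the multiplier algebra. -/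
def betaStar : Representation K G (MultiplierAlgebra K B) where
  toFun := E.conjMap
  map_one' := by
    refine LinearMap.ext fun u => Subtype.ext (Prod.ext ?_ ?_)
    · apply MulOpposite.unop_injective
      ext b
      simp [conjMap]
      rfl
    · ext b
      simp [conjMap]
      rfl
  map_mul' g h := by
    refine LinearMap.ext fun u => Subtype.ext (Prod.ext ?_ ?_)
    · apply MulOpposite.unop_injective
      ext b
      simp [conjMap]
      rfl
    · ext b
      simp [conjMap]
      rfl

end GlobalAction

/-- An enveloping action of a partial action `α` of `G` on `A`: a global action `β` of `G` on `B`
together with an isomorphism `φ` of `A` onto an ideal of `B` such that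
`φ(D_g) = φ(A) ∩ β_g(φ(A))`, `φ ∘ α_g = β_g ∘ φ` on `D_{g⁻¹}` and `B = ∑_g β_g(φ(A))`. -/
structure EnvelopingAction {K G A : Type*} [CommRing K] [Group G] [NonUnitalRing A] [Module K A]
    [IsScalarTower K A A] [SMulCommClass K A A] (α : PartialAction K G A) (B : Type*)
    [NonUnitalRing B] [Module K B] [IsScalarTower K B B] [SMulCommClass K B B]
    extends GlobalAction K G B where
  φ : A →ₙₐ[K] B
  φ_injective : Function.Injective φ
  mul_mem_range : ∀ b a, b * φ a ∈ Set.range φ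
  mem_range_mul : ∀ b a, φ a * b ∈ Set.range φ
  image_domain : ∀ g, φ '' (α.domain g) = Set.range φ ∩ β g '' Set.range φ
  φ_act : ∀ g (a : α.domain g⁻¹), φ (α.act g a) = β g (φ a)
  span_eq_top : Submodule.span K (⋃ g, β g '' Set.range φ) = ⊤

/-- `u` is a globalization of `w : Gⁿ → A`: it is a usual `n`-cocycle of `G` with values in the
additive group of `M(B)` whose restriction to `A` is `w`, that is,
`φ(w(g₁,…,gₙ)) = φ(1_{(g₁,…,gₙ)}) u(g₁,…,gₙ)`. -/
def IsGlobalization {K G A B : Type*} [CommRing K] [Group G] [Ring A] [Algebra K A]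
    [NonUnitalRing B] [Module K B] [IsScalarTower K B B] [SMulCommClass K B B]
    (α : UnitalPartialAction K G A) (E : EnvelopingAction α.toPartialAction B) {n : ℕ}
    (w : (Fin n → G) → A) (u : (Fin n → G) → MultiplierAlgebra K B) : Prop :=
  u ∈ usualCocycles E.betaStar n ∧
    ∀ g, E.φ (w g) = MultiplierAlgebra.rightMul (E.φ (α.unitTuple g)) (u g)

/-- A unital ring is indecomposable if it is nonzero and has no central idempotents other than
`0` and `1`, that is, if it is not a product of two nonzero rings. -/
def IsIndecomposableRing (R : Type*) [Ring R] : Prop :=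
  Nontrivial R ∧ ∀ e : R, IsIdempotentElem e → (∀ x, Commute e x) → e = 0 ∨ e = 1

/-! The algebra `B` decomposes along its central atoms, which are exactly the translates under `β`
of the images of the coordinate idempotents of the product (`isCentralAtom_φ_single`,
`exists_eq_β_φ_single`). Elements of `B` are determined by their components at the atoms
(`eq_of_atom_mul_eq`), and every choice of components `c e` with `e * c e = c e` comes from a
multiplier (`exists_multiplier`). So the globalization can be built one atom at a time.

Replace `(g₁, …, gₙ)` by the vertices `1, g₁, g₁g₂, …`. For an atom `e`, let `X_e` be the set of `h`
such that `e` lies under `β_h(φ(1))`, that is, `e * E.β h (E.φ 1) = e`. On vertices from `X_e` all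
the idempotents in the partial cocycle identity act trivially, and `w` becomes an ordinary
homogeneous cocycle with values in `eB` (`homogeneous_cocycle`). Since `X_e` is nonempty, there is a
retraction `anchor e` of `G` onto `X_e`, and it can be chosen compatibly with translation by `G`.
Pulling back along it extends the cocycle to all vertices: equivariance gives the global cocycle
identity (`component_cocycle`), and the retraction property gives back `w` on `A`
(`mul_φ_eq_mul_component`). -/

/-! ### Central idempotents and central atoms -/

/-- A central idempotent of a not necessarily unital ring. -/
structure IsCentralIdempotent {R : Type*} [NonUnitalRing R] (e : R) : Prop where
  idem : e * e = e
  comm : ∀ x, e * x = x * e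

/-- A minimal nonzero central idempotent. -/
structure IsCentralAtom {R : Type*} [NonUnitalRing R] (e : R) : Prop
    extends IsCentralIdempotent e where
  ne_zero : e ≠ 0
  dichotomy : ∀ f, IsCentralIdempotent f → e * f = 0 ∨ e * f = e

namespace IsCentralIdempotent

theorem one {R : Type*} [Ring R] : IsCentralIdempotent (1 : R) := ⟨by simp, by simp⟩

theorem mul {R : Type*} [NonUnitalRing R] {e f : R} (he : IsCentralIdempotent e)
    (hf : IsCentralIdempotent f) : IsCentralIdempotent (e * f) where
  idem := by rw [mul_assoc, ← mul_assoc f, ← he.comm f, mul_assoc e f f, hf.idem, ← mul_assoc,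
    he.idem]
  comm x := by rw [mul_assoc, hf.comm, ← mul_assoc, he.comm, mul_assoc]

theorem mul_self_mul {R : Type*} [NonUnitalRing R] {e : R} (he : IsCentralIdempotent e) (x : R) :
    e * (e * x) = e * x := by rw [← mul_assoc, he.idem]

theorem mul_left_comm {R : Type*} [NonUnitalRing R] {e : R} (he : IsCentralIdempotent e)
    (x y : R) : x * (e * y) = e * (x * y) := by rw [← mul_assoc, ← he.comm, mul_assoc]

theorem list_prod {R : Type*} [Ring R] :
    ∀ {l : List R}, (∀ x ∈ l, IsCentralIdempotent x) → IsCentralIdempotent l.prod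
  | [], _ => by simpa using one
  | x :: l, h => by
    rw [List.prod_cons]
    exact (h x (by simp)).mul (list_prod fun y hy => h y (by simp [hy]))

theorem mul_list_prod {R : Type*} [Ring R] {l : List R} (hl : ∀ x ∈ l, IsCentralIdempotent x)
    {x : R} (hx : x ∈ l) : x * l.prod = l.prod := by
  induction l with
  | nil => simp at hx
  | cons y l ih =>
    rw [List.prod_cons]
    rcases List.mem_cons.1 hx with rfl | hx
    · exact (hl x (by simp)).mul_self_mul _
    · rw [(hl y (by simp)).mul_left_comm, ih (fun z hz => hl z (by simp [hz])) hx]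

theorem pi_apply {ι : Type*} {A : ι → Type*} [∀ i, Ring (A i)] {x : ∀ i, A i}
    (hx : IsCentralIdempotent x) (i : ι) : IsCentralIdempotent (x i) where
  idem := congrFun hx.idem i
  comm y := by
    classical
    simpa using congrFun (hx.comm (Pi.single i y)) i

theorem pi_single {ι : Type*} [DecidableEq ι] (A : ι → Type*) [∀ i, Ring (A i)] (i : ι) :
    IsCentralIdempotent (Pi.single i (1 : A i)) where
  idem := by rw [← Pi.single_mul, one_mul]
  comm x := by
    ext j
    by_cases h : j = i
    · subst h; simp
    · simp [h]

theorem eq_zero_or_one {R : Type*} [Ring R] (hR : IsIndecomposableRing R) {e : R}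
    (he : IsCentralIdempotent e) : e = 0 ∨ e = 1 :=
  hR.2 e he.idem he.comm

end IsCentralIdempotent

namespace IsCentralAtom

variable {R : Type*} [NonUnitalRing R] {e f : R}

theorem eq_of_mul_ne_zero (he : IsCentralAtom e) (hf : IsCentralAtom f) (h : e * f ≠ 0) :
    e = f := by
  have h1 := (he.dichotomy f hf.toIsCentralIdempotent).resolve_left h
  have h2 := (hf.dichotomy e he.toIsCentralIdempotent).resolve_left (by rwa [← he.comm])
  rw [← h1, he.comm, h2]

end IsCentralAtom

/-! ### Evaluation of multipliers, and transport along the global action. -/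

namespace MultiplierAlgebra

variable {K B : Type*} [CommRing K] [NonUnitalRing B] [Module K B]
    [IsScalarTower K B B] [SMulCommClass K B B]

/-- The additive map `u ↦ b u`. -/
def rightMulHom (b : B) : MultiplierAlgebra K B →+ B where
  toFun := rightMul b
  map_zero' := rfl
  map_add' _ _ := rfl

/-- The additive map `u ↦ u b`. -/
def leftMulHom (b : B) : MultiplierAlgebra K B →+ B where
  toFun u := leftMul u b
  map_zero' := rfl
  map_add' _ _ := rfl

theorem ext_mul {u v : MultiplierAlgebra K B} (hR : ∀ b, rightMulHom b u = rightMulHom b v)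
    (hL : ∀ b, leftMulHom b u = leftMulHom b v) : u = v :=
  Subtype.ext (Prod.ext (MulOpposite.unop_injective (LinearMap.ext hR)) (LinearMap.ext hL))

end MultiplierAlgebra

namespace GlobalAction

variable {K G B : Type*} [CommRing K] [Group G] [NonUnitalRing B] [Module K B]
    [IsScalarTower K B B] [SMulCommClass K B B] (E : GlobalAction K G B)

theorem β_comp (g h : G) (b : B) : E.β g (E.β h b) = E.β (g * h) b := by
  rw [map_mul]; rfl

theorem β_one (b : B) : E.β 1 b = b := by
  rw [map_one]; rfl

theorem β_inv_apply (g : G) (b : B) : E.β g⁻¹ (E.β g b) = b := by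
  rw [β_comp, inv_mul_cancel, β_one]

theorem β_apply_inv (g : G) (b : B) : E.β g (E.β g⁻¹ b) = b := by
  rw [β_comp, mul_inv_cancel, β_one]

theorem β_symm (g : G) : (E.β g).symm = E.β g⁻¹ := by
  ext b
  rw [LinearEquiv.symm_apply_eq, β_apply_inv]

theorem rightMulHom_betaStar (g : G) (u : MultiplierAlgebra K B) (b : B) :
    MultiplierAlgebra.rightMulHom b (E.betaStar g u) =
      E.β g (MultiplierAlgebra.rightMul (E.β g⁻¹ b) u) := by
  rw [← β_symm]; rfl

theorem leftMulHom_betaStar (g : G) (u : MultiplierAlgebra K B) (b : B) :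
    MultiplierAlgebra.leftMulHom b (E.betaStar g u) =
      E.β g (MultiplierAlgebra.leftMul u (E.β g⁻¹ b)) := by
  rw [← β_symm]; rfl

theorem isCentralIdempotent_β {e : B} (he : IsCentralIdempotent e) (g : G) :
    IsCentralIdempotent (E.β g e) where
  idem := by rw [← E.β_mul, he.idem]
  comm x := by
    rw [← E.β_apply_inv g x, ← E.β_mul, he.comm, E.β_mul]

theorem isCentralAtom_β {e : B} (he : IsCentralAtom e) (g : G) : IsCentralAtom (E.β g e) where
  toIsCentralIdempotent := E.isCentralIdempotent_β he.toIsCentralIdempotent g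
  ne_zero := by simpa using he.ne_zero
  dichotomy f hf := by
    rw [← E.β_apply_inv g f, ← E.β_mul]
    rcases he.dichotomy _ (E.isCentralIdempotent_β hf g⁻¹) with h | h <;> rw [h]
    · exact Or.inl (map_zero _)
    · exact Or.inr rfl

end GlobalAction

/-! ### Central idempotents of an enveloping action -/

namespace UnitalPartialAction

variable {K G A : Type*} [CommRing K] [Group G] [Ring A] [Algebra K A]
  (α : UnitalPartialAction K G A)

theorem isCentralIdempotent_unit (g : G) : IsCentralIdempotent (α.unit g) :=
  ⟨α.unit_idem g, α.unit_central g⟩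

theorem isCentralIdempotent_unitTuple {n : ℕ} (g : Fin n → G) :
    IsCentralIdempotent (α.unitTuple g) :=
  IsCentralIdempotent.list_prod fun x hx => by
    obtain ⟨i, rfl⟩ := (List.mem_ofFn' _ _).1 hx
    exact α.isCentralIdempotent_unit _

theorem unit_mul_unitTuple {n : ℕ} (g : Fin n → G) (i : Fin n) :
    α.unit (Fin.partialProd g i.succ) * α.unitTuple g = α.unitTuple g :=
  IsCentralIdempotent.mul_list_prod (fun x hx => by
    obtain ⟨i, rfl⟩ := (List.mem_ofFn' _ _).1 hx
    exact α.isCentralIdempotent_unit _) ((List.mem_ofFn' _ _).2 ⟨i, rfl⟩)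

theorem inducedModule_eTuple {n : ℕ} (g : Fin n → G) (a : A) :
    α.inducedModule (ParGroupAlgebra.eTuple K g) a = α.unitTuple g * a := by
  have key : ∀ l : List G, α.inducedModule (l.map (ParGroupAlgebra.e K)).prod a =
      (l.map α.unit).prod * a := by
    intro l
    induction l with
    | nil => simp
    | cons x l ih =>
      rw [List.map_cons, List.prod_cons, map_mul, Module.End.mul_apply, ih, inducedModule_e,
        List.map_cons, List.prod_cons, mul_assoc]
  have := key (List.ofFn fun i : Fin n => Fin.partialProd g i.succ)
  rwa [List.map_ofFn, List.map_ofFn] at this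

end UnitalPartialAction

namespace EnvelopingAction

section Ring

variable {K G A B : Type*} [CommRing K] [Group G] [Ring A] [Algebra K A]
  [NonUnitalRing B] [Module K B] [IsScalarTower K B B] [SMulCommClass K B B]

section PartialAction

variable {α : PartialAction K G A} (E : EnvelopingAction α B)

/-- Both `φ(a)b` and `bφ(a)` lie in the ideal `φ(A)`, where `φ(a)` is central; hence both equal
`φ(a)bφ(a)`. -/
theorem isCentralIdempotent_φ {a : A} (ha : IsCentralIdempotent a) :
    IsCentralIdempotent (E.φ a) where
  idem := by rw [← map_mul, ha.idem]
  comm b := by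
    obtain ⟨x, hx⟩ := E.mem_range_mul b a
    obtain ⟨y, hy⟩ := E.mul_mem_range b a
    have h1 : E.φ a * b = E.φ a * b * E.φ a := by
      conv_lhs => rw [← ha.idem, map_mul, mul_assoc, ← hx, ← map_mul, ha.comm, map_mul, hx]
    have h2 : b * E.φ a = E.φ a * (b * E.φ a) := by
      conv_lhs => rw [← ha.idem, map_mul, ← mul_assoc, ← hy, ← map_mul, ← ha.comm, map_mul, hy]
    rw [h1, h2, mul_assoc]

theorem isCentralIdempotent_β_φ_one (g : G) : IsCentralIdempotent (E.β g (E.φ 1)) :=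
  E.isCentralIdempotent_β (E.isCentralIdempotent_φ IsCentralIdempotent.one) g

theorem φ_one_mul (a : A) : E.φ 1 * E.φ a = E.φ a := by rw [← map_mul, one_mul]

theorem exists_φ_eq {b : B} (h : b * E.φ 1 = b) : ∃ a, E.φ a = b := by
  rw [← h]; exact E.mul_mem_range b 1

theorem isCentralIdempotent_of_φ {a : A} (ha : IsCentralIdempotent (E.φ a)) :
    IsCentralIdempotent a where
  idem := E.φ_injective (by rw [map_mul, ha.idem])
  comm x := E.φ_injective (by rw [map_mul, map_mul, ha.comm])

@[elab_as_elim]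
theorem β_φ_induction {p : B → Prop} (h : ∀ g a, p (E.β g (E.φ a))) (h0 : p 0)
    (hadd : ∀ x y, p x → p y → p (x + y)) (hsmul : ∀ (k : K) x, p x → p (k • x)) (b : B) :
    p b := by
  have hb : b ∈ Submodule.span K (⋃ g, E.β g '' Set.range E.φ) := by
    rw [E.span_eq_top]; trivial
  induction hb using Submodule.span_induction with
  | mem x hx =>
    obtain ⟨g, hx⟩ := Set.mem_iUnion.1 hx
    obtain ⟨_, ⟨a, rfl⟩, rfl⟩ := hx
    exact h g a
  | zero => exact h0
  | add x y _ _ hx hy => exact hadd x y hx hy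
  | smul k x _ hx => exact hsmul k x hx

/-- An enveloping algebra has local units. -/
theorem exists_local_unit (E : EnvelopingAction α B) (b : B) : ∃ e : B, IsCentralIdempotent e ∧ e * b = b := by
  refine E.β_φ_induction (fun g a => ?_) ?_ (fun x y hx hy => ?_) (fun k x hx => ?_) b
  · exact ⟨_, E.isCentralIdempotent_β_φ_one g, by rw [← E.β_mul, φ_one_mul]⟩
  · exact ⟨_, E.isCentralIdempotent_β_φ_one 1, mul_zero _⟩
  · obtain ⟨e, he, hx⟩ := hx
    obtain ⟨f, hf, hy⟩ := hy
    have hff : f * (e * f) = e * f := by rw [he.mul_left_comm, hf.idem]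
    -- The join of the two central idempotents fixes everything fixed by `e` or by `f`.
    refine ⟨e + f - e * f, ⟨?_, fun z => ?_⟩, ?_⟩
    · have h1 := he.idem
      have h2 := hf.idem
      have h4 := he.comm f
      have h5 := he.mul_self_mul f
      simp only [sub_mul, mul_sub, add_mul, mul_add, mul_assoc] at *
      simp only [h1, h2, ← h4, h5, hff]
      abel
    · simp only [sub_mul, mul_sub, add_mul, mul_add, he.comm z, hf.comm z, (he.mul hf).comm z]
    · have h1 : e * f * x = f * x := by rw [he.comm, mul_assoc, hx]
      have h2 : e * f * y = e * y := by rw [mul_assoc, hy]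
      simp only [sub_mul, add_mul, mul_add, h1, h2, hx, hy]
      abel
  · obtain ⟨e, he, hx⟩ := hx
    exact ⟨e, he, by rw [mul_smul_comm, hx]⟩

/-- A local unit of `b` is a combination of elements `β_g(φ(a)) = β_g(φ(a)) β_g(φ(1))`, each of
which kills `b`. -/
theorem eq_zero_of_β_φ_one_mul {b : B} (h : ∀ g, E.β g (E.φ 1) * b = 0) : b = 0 := by
  obtain ⟨e, he, hb⟩ := E.exists_local_unit b
  rw [← hb]
  clear hb he
  refine E.β_φ_induction (fun g a => ?_) ?_ (fun x y hx hy => ?_) (fun k x hx => ?_) e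
  · rw [← mul_one a, map_mul, E.β_mul, mul_assoc, h, mul_zero]
  · exact zero_mul b
  · rw [add_mul, hx, hy, add_zero]
  · rw [smul_mul_assoc, hx, smul_zero]

/-- Otherwise the atom would be orthogonal to every `β_g(φ(1))`, hence zero. This makes `X_e`
nonempty. -/
theorem exists_mul_β_φ_one {e : B} (he : IsCentralAtom e) : ∃ g, e * E.β g (E.φ 1) = e := by
  by_contra! h
  refine he.ne_zero (E.eq_zero_of_β_φ_one_mul fun g => ?_)
  rw [← he.comm]
  exact (he.dichotomy _ (E.isCentralIdempotent_β_φ_one g)).resolve_right (h g)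

end PartialAction

section UnitalPartialAction

variable {α : UnitalPartialAction K G A} (E : EnvelopingAction α.toPartialAction B)

/-- Both sides belong to `φ(A) ∩ β_g(φ(A)) = φ(D_g)` and act on it as the identity. -/
theorem φ_unit (g : G) : E.φ (α.unit g) = E.φ 1 * E.β g (E.φ 1) := by
  have h1 : E.φ (α.unit g) * (E.φ 1 * E.β g (E.φ 1)) = E.φ 1 * E.β g (E.φ 1) := by
    have hm : E.φ 1 * E.β g (E.φ 1) ∈ E.φ '' (α.domain g) := by
      rw [E.image_domain]
      refine ⟨E.mem_range_mul _ _, ?_⟩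
      obtain ⟨a, ha⟩ := E.mul_mem_range (E.β g⁻¹ (E.φ 1)) 1
      exact ⟨E.φ a, ⟨a, rfl⟩, by rw [ha, E.β_mul, E.β_apply_inv]⟩
    obtain ⟨a, ha, h⟩ := hm
    rw [← h, ← map_mul, α.unit_mul_of_mem ha]
  have hm : E.φ (α.unit g) ∈ E.φ '' (α.domain g) :=
    ⟨_, by simpa using α.unit_mul_mem g 1, rfl⟩
  rw [E.image_domain] at hm
  obtain ⟨_, _, ⟨a, rfl⟩, h⟩ := hm
  rw [← h1, ← mul_assoc, ← map_mul, mul_one, ← h, ← E.β_mul, ← map_mul, mul_one]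

theorem φ_piMap (g : G) (a : A) :
    E.φ (α.piMap g a) = E.φ 1 * E.β g (E.φ a) := by
  rw [α.piMap_apply, E.φ_act, map_mul, φ_unit, E.β_mul, E.β_mul, E.β_apply_inv,
    ← (E.isCentralIdempotent_φ IsCentralIdempotent.one).comm, mul_assoc, ← E.β_mul, φ_one_mul]

end UnitalPartialAction

end Ring

end EnvelopingAction

namespace EnvelopingAction

/-! ### Atoms of an enveloping algebra of a product of indecomposable rings -/

section Product

variable {K G ι B : Type*} [CommRing K] [Group G] {A : ι → Type*} [∀ i, Ring (A i)]
  [∀ i, Algebra K (A i)] [NonUnitalRing B] [Module K B] [IsScalarTower K B B]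
  [SMulCommClass K B B] {α : PartialAction K G (∀ i, A i)} (E : EnvelopingAction α B)

theorem single_mul_eq [DecidableEq ι] (i : ι) (x : ∀ i, A i) :
    Pi.single i (1 : A i) * x = Pi.single i (x i) := by
  ext j
  by_cases h : j = i
  · subst h; simp
  · simp [h]

/-- Multiplying a central idempotent of `B` by this element gives the image of a central idempotent
supported at `i`, whose only coordinate is `0` or `1` by indecomposability. -/
theorem isCentralAtom_φ_single [DecidableEq ι] (hA : ∀ i, IsIndecomposableRing (A i)) (i : ι) :
    IsCentralAtom (E.φ (Pi.single i (1 : A i))) where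
  toIsCentralIdempotent := E.isCentralIdempotent_φ (IsCentralIdempotent.pi_single A i)
  ne_zero h := by
    have := (hA i).1
    have h1 := E.φ_injective (h.trans (map_zero E.φ).symm)
    exact one_ne_zero (Pi.single_eq_zero_iff.1 h1)
  dichotomy f hf := by
    have hi := E.isCentralIdempotent_φ (IsCentralIdempotent.pi_single A i)
    obtain ⟨x, hx⟩ := E.mem_range_mul f (Pi.single i (1 : A i))
    have hxi : Pi.single i (1 : A i) * x = x :=
      E.φ_injective (by rw [map_mul, hx, hi.mul_self_mul])
    have hxc : IsCentralIdempotent x := E.isCentralIdempotent_of_φ (hx ▸ hi.mul hf)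
    rw [single_mul_eq] at hxi
    rw [← hx, ← hxi]
    rcases (hxc.pi_apply i).eq_zero_or_one (hA i) with h | h <;> rw [h]
    · left; simp
    · exact Or.inr rfl

/-- The preimage of `e` in the product has some coordinate equal to `1`, so `e` meets the
corresponding atom, and two atoms with nonzero product coincide. -/
theorem exists_eq_φ_single [DecidableEq ι] (hA : ∀ i, IsIndecomposableRing (A i)) {e : B}
    (he : IsCentralAtom e) (h : e * E.φ 1 = e) : ∃ i, e = E.φ (Pi.single i (1 : A i)) := by
  obtain ⟨x, rfl⟩ := E.exists_φ_eq h
  have hx := E.isCentralIdempotent_of_φ he.toIsCentralIdempotent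
  have hx0 : x ≠ 0 := fun h0 => he.ne_zero (by rw [h0, map_zero])
  obtain ⟨i, hi⟩ := Function.ne_iff.1 hx0
  have hi1 := ((hx.pi_apply i).eq_zero_or_one (hA i)).resolve_left hi
  refine ⟨i, he.eq_of_mul_ne_zero (E.isCentralAtom_φ_single hA i) ?_⟩
  rw [he.comm, ← map_mul, single_mul_eq, hi1]
  exact (E.isCentralAtom_φ_single hA i).ne_zero

theorem exists_eq_β_φ_single [DecidableEq ι] (hA : ∀ i, IsIndecomposableRing (A i)) {e : B}
    (he : IsCentralAtom e) {g : G} (h : e * E.β g (E.φ 1) = e) :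
    ∃ i, e = E.β g (E.φ (Pi.single i (1 : A i))) := by
  obtain ⟨i, hi⟩ := E.exists_eq_φ_single hA (E.isCentralAtom_β he g⁻¹)
    (by conv_rhs => rw [← h, E.β_mul, E.β_inv_apply])
  exact ⟨i, by rw [← hi, E.β_apply_inv]⟩

/-- The central atoms separate the elements of an enveloping algebra. -/
theorem eq_of_atom_mul_eq (E : EnvelopingAction α B) (hA : ∀ i, IsIndecomposableRing (A i))
    {b c : B} (h : ∀ e, IsCentralAtom e → e * b = e * c) : b = c := by
  classical
  rw [← sub_eq_zero]
  refine E.eq_zero_of_β_φ_one_mul fun g => ?_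
  -- The part of `b - c` in `β_g(φ(A))` is `β_g(φ(x))`; the translated coordinate atoms detect each
  -- coordinate of `x`.
  obtain ⟨x, hx⟩ := E.mem_range_mul (E.β g⁻¹ (b - c)) 1
  have hx' : E.β g (E.φ x) = E.β g (E.φ 1) * (b - c) := by
    rw [hx, E.β_mul, E.β_apply_inv]
  rw [← hx']
  suffices x = 0 by rw [this, map_zero, map_zero]
  funext i
  have ha := E.isCentralAtom_β (E.isCentralAtom_φ_single hA i) g
  have h0 : E.β g (E.φ (Pi.single i (1 : A i))) * E.β g (E.φ x) = 0 := by
    rw [hx', (E.isCentralIdempotent_β_φ_one g).mul_left_comm, mul_sub, h _ ha, sub_self, mul_zero]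
  rw [← E.β_mul, ← map_mul, single_mul_eq, ← map_zero (E.β g), (E.β g).injective.eq_iff,
    ← map_zero E.φ, E.φ_injective.eq_iff] at h0
  exact Pi.single_eq_zero_iff.1 h0

/-- A family of components supported on a translate of `φ(A)` comes from an element. -/
theorem exists_atom_mul_eq (hA : ∀ i, IsIndecomposableRing (A i)) (g : G) (d : B → B)
    (hd : ∀ e, IsCentralAtom e → e * d e = d e)
    (hg : ∀ e, IsCentralAtom e → e * E.β g (E.φ 1) = 0 → d e = 0) :
    ∃ y, ∀ e, IsCentralAtom e → e * y = d e := by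
  classical
  have hz : ∀ i, ∃ a, E.φ a = E.φ (Pi.single i (1 : A i)) *
      E.β g⁻¹ (d (E.β g (E.φ (Pi.single i (1 : A i))))) := fun i => E.mem_range_mul _ _
  choose a ha using hz
  -- Only the `i`-th coordinate of `a i` matters. Gluing infinitely many of them is possible because
  -- the algebra is the full direct product.
  refine ⟨E.β g (E.φ fun i => a i i), fun e he => ?_⟩
  rcases he.dichotomy _ (E.isCentralIdempotent_β_φ_one g) with h | h
  · rw [hg e he h, ← φ_one_mul, E.β_mul, ← mul_assoc, h, zero_mul]
  · obtain ⟨i, rfl⟩ := E.exists_eq_β_φ_single hA he h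
    rw [← E.β_mul, ← map_mul, single_mul_eq, ← single_mul_eq i (a i), map_mul, ha,
      (E.isCentralAtom_φ_single hA i).mul_self_mul, E.β_mul, E.β_apply_inv, hd _ he]

/-- For `b` in `β_g(φ(A))` the family `c e * b` vanishes at atoms orthogonal to `β_g(φ(1))`, so it
can be glued; such `b` span `B`. -/
theorem exists_left (hA : ∀ i, IsIndecomposableRing (A i)) (E : EnvelopingAction α B) {c : B → B}
    (hc : ∀ e, IsCentralAtom e → e * c e = c e) (b : B) :
    ∃ y, ∀ e, IsCentralAtom e → e * y = c e * b := by
  refine E.β_φ_induction (fun g a => ?_) ⟨0, by simp⟩ (fun x y hx hy => ?_) (fun k x hx => ?_) b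
  · refine E.exists_atom_mul_eq hA g _ (fun e he => by rw [← mul_assoc, hc e he])
      fun e he h => ?_
    rw [← φ_one_mul, E.β_mul, ← hc e he, he.comm, mul_assoc, ← mul_assoc e, h, zero_mul, mul_zero]
  · obtain ⟨x', hx⟩ := hx
    obtain ⟨y', hy⟩ := hy
    exact ⟨x' + y', fun e he => by rw [mul_add, mul_add, hx e he, hy e he]⟩
  · obtain ⟨x', hx⟩ := hx
    exact ⟨k • x', fun e he => by rw [mul_smul_comm, mul_smul_comm, hx e he]⟩

theorem exists_right (hA : ∀ i, IsIndecomposableRing (A i)) (E : EnvelopingAction α B)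
    {c : B → B} (hc : ∀ e, IsCentralAtom e → e * c e = c e) (b : B) :
    ∃ y, ∀ e, IsCentralAtom e → e * y = b * c e := by
  refine E.β_φ_induction (fun g a => ?_) ⟨0, by simp⟩ (fun x y hx hy => ?_) (fun k x hx => ?_) b
  · refine E.exists_atom_mul_eq hA g _ (fun e he => by rw [← he.mul_left_comm, hc e he])
      fun e he h => ?_
    rw [← φ_one_mul, E.β_mul, (E.isCentralIdempotent_β_φ_one g).comm, ← hc e he, mul_assoc,
      ← mul_assoc _ e, ← he.comm, h, zero_mul, mul_zero]
  · obtain ⟨x', hx⟩ := hx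
    obtain ⟨y', hy⟩ := hy
    exact ⟨x' + y', fun e he => by rw [mul_add, add_mul, hx e he, hy e he]⟩
  · obtain ⟨x', hx⟩ := hx
    exact ⟨k • x', fun e he => by rw [mul_smul_comm, smul_mul_assoc, hx e he]⟩

/-- A family `c` with `c e ∈ e B` for all central atoms `e` defines a multiplier. -/
theorem exists_multiplier (hA : ∀ i, IsIndecomposableRing (A i)) (E : EnvelopingAction α B)
    {c : B → B} (hc : ∀ e, IsCentralAtom e → e * c e = c e) :
    ∃ u : MultiplierAlgebra K B, ∀ e, IsCentralAtom e → ∀ b,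
      e * MultiplierAlgebra.rightMul b u = b * c e ∧
      e * MultiplierAlgebra.leftMul u b = c e * b := by
  choose L hL using E.exists_left hA hc
  choose R hR using E.exists_right hA hc
  -- The values chosen for `L` and `R` are unique, which is why they are linear and satisfy the
  -- multiplier identities.
  have ext {x y : B} (h : ∀ e, IsCentralAtom e → e * x = e * y) : x = y := E.eq_of_atom_mul_eq hA h
  let L' : Module.End K B :=
    { toFun := L
      map_add' := fun x y => ext fun e he => by
        rw [mul_add, hL _ _ he, hL _ _ he, hL _ _ he, mul_add]
      map_smul' := fun k x => ext fun e he => by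
        rw [RingHom.id_apply, mul_smul_comm, hL _ _ he, hL _ _ he, mul_smul_comm] }
  let R' : Module.End K B :=
    { toFun := R
      map_add' := fun x y => ext fun e he => by
        rw [mul_add, hR _ _ he, hR _ _ he, hR _ _ he, add_mul]
      map_smul' := fun k x => ext fun e he => by
        rw [RingHom.id_apply, mul_smul_comm, hR _ _ he, hR _ _ he, smul_mul_assoc] }
  refine ⟨⟨(MulOpposite.op R', L'), fun x y => ext fun e he => ?_, fun x y => ext fun e he => ?_,
    fun x y => ext fun e he => ?_⟩, fun e he b => ⟨hR b e he, hL b e he⟩⟩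
  · change e * R (x * y) = e * (x * R y)
    rw [hR _ _ he, ← he.mul_left_comm, hR _ _ he, mul_assoc]
  · change e * L (x * y) = e * (L x * y)
    rw [hL _ _ he, ← mul_assoc, ← mul_assoc e, hL _ _ he]
  · change e * (R x * y) = e * (x * L y)
    rw [← mul_assoc, hR _ _ he, ← he.mul_left_comm, hL _ _ he, mul_assoc]

end Product

/-! ### Moving points of the orbit of an atom into the partial action -/

section Slide

variable {K G A B : Type*} [CommRing K] [Group G] [Ring A] [Algebra K A]
  [NonUnitalRing B] [Module K B] [IsScalarTower K B B] [SMulCommClass K B B]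
  {α : PartialAction K G A} (E : EnvelopingAction α B)

open Classical in
/-- An element `t` with `e ≤ β_t(φ(1))`, equal to `1` if possible. -/
noncomputable def slide (e : B) : G :=
  -- The final `1` is a default that is never reached when `e` is an atom.
  if e * E.φ 1 = e then 1 else if h : ∃ g, e * E.β g (E.φ 1) = e then h.choose else 1

theorem mul_β_slide {e : B} (he : IsCentralAtom e) : e * E.β (E.slide e) (E.φ 1) = e := by
  unfold slide
  split_ifs with h1 h2
  · rwa [E.β_one]
  · exact h2.choose_spec
  · exact absurd (E.exists_mul_β_φ_one he) h2

/-- A `G`-equivariant choice, for the points of the orbit of `e`, of translates of `φ(A)` that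
contain `e`. -/
noncomputable def anchor (e : B) (h : G) : G := h * E.slide (E.β h⁻¹ e)

/-- Both sides use the slide of the same element `β_{(gh)⁻¹}(e)`. This equivariance handles the
leading term of the coboundary. -/
theorem anchor_translate (e : B) (g h : G) : g * E.anchor (E.β g⁻¹ e) h = E.anchor e (g * h) := by
  rw [anchor, anchor, E.β_comp, mul_inv_rev, mul_assoc]

theorem mul_β_anchor {e : B} (he : IsCentralAtom e) (h : G) :
    e * E.β (E.anchor e h) (E.φ 1) = e := by
  have := congrArg (E.β h) (E.mul_β_slide (E.isCentralAtom_β he h⁻¹))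
  rwa [E.β_mul, E.β_apply_inv, E.β_comp] at this

/-- The preference of `slide` for `1` makes `anchor e` a retraction; this is what makes the
extension restrict to `w`. -/
theorem anchor_eq_self {e : B} {h : G} (he : e * E.β h (E.φ 1) = e) : E.anchor e h = h := by
  rw [anchor, slide, if_pos, mul_one]
  conv_rhs => rw [← he, E.β_mul, E.β_inv_apply]

end Slide

end EnvelopingAction

/-! ### Homogeneous coordinates -/

/-- The tuple `(Q₀⁻¹Q₁, …, Qₙ₋₁⁻¹Qₙ)`. -/
def successiveQuotients {G : Type*} [Group G] {n : ℕ} (Q : Fin (n + 1) → G) : Fin n → G :=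
  fun i => (Q i.castSucc)⁻¹ * Q i.succ

section successiveQuotients

variable {G : Type*} [Group G] {n : ℕ}

theorem successiveQuotients_partialProd (g : Fin n → G) :
    successiveQuotients (Fin.partialProd g) = g :=
  funext fun i => Fin.partialProd_right_inv g i

theorem partialProd_successiveQuotients (Q : Fin (n + 1) → G) (j : Fin (n + 1)) :
    Fin.partialProd (successiveQuotients Q) j = (Q 0)⁻¹ * Q j := by
  rw [eq_inv_mul_iff_mul_eq]
  exact congrFun (Fin.partialProd_left_inv Q) j

theorem successiveQuotients_mul_left (g : G) (Q : Fin (n + 1) → G) :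
    successiveQuotients (fun j => g * Q j) = successiveQuotients Q := by
  funext i
  simp [successiveQuotients, mul_assoc]

/-- Multiplying neighbouring quotients deletes the vertex between them; for the last `j`, dropping
the last quotient deletes the last vertex. Partial products recover the vertices only up to left
translation by `Q 0`, which the quotients do not see. -/
theorem contractNth_successiveQuotients (Q : Fin (n + 2) → G) (j : Fin (n + 1)) :
    Fin.contractNth j (· * ·) (successiveQuotients Q) =
      successiveQuotients (Q ∘ j.succ.succAbove) := by
  rw [← successiveQuotients_partialProd (Fin.contractNth j (· * ·) (successiveQuotients Q)),
    Fin.partialProd_contractNth, ← successiveQuotients_mul_left (Q 0)]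
  congr 1
  funext k
  simp [partialProd_successiveQuotients]

end successiveQuotients

/-! ### The homogeneous cochain at an atom and its extension to all vertices. -/

namespace EnvelopingAction

variable {K G A B : Type*} [CommRing K] [Group G] [Ring A] [Algebra K A]
  [NonUnitalRing B] [Module K B] [IsScalarTower K B B] [SMulCommClass K B B]
  {α : UnitalPartialAction K G A} (E : EnvelopingAction α.toPartialAction B)

/-- The component at `e` of the homogeneous cochain corresponding to `w`. -/
def homogeneous {n : ℕ} (w : (Fin n → G) → A) (e : B) (Q : Fin (n + 1) → G) : B :=
  e * E.β (Q 0) (E.φ (w (successiveQuotients Q)))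

/-- Apply `e * β_{Q 0}(φ(·))` to the partial cocycle identity. Each idempotent in it turns into
factors `β_{Q j}(φ(1))`, which `e` absorbs by `hQ`. -/
theorem homogeneous_cocycle {n : ℕ} {w : (Fin n → G) → A}
    (hw : w ∈ parCocycles α.inducedModule n) (e : B) (Q : Fin (n + 2) → G)
    (hQ : ∀ j, e * E.β (Q j) (E.φ 1) = e) :
    E.homogeneous w e (Q ∘ Fin.succ) + ∑ j : Fin (n + 1), (-1 : ℤ) ^ ((j : ℕ) + 1) •
      E.homogeneous w e (Q ∘ j.succ.succAbove) = 0 := by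
  have h := congrFun ((AddMonoidHom.mem_ker).1 hw.2) (successiveQuotients Q)
  have h' := congrArg (fun x => e * E.β (Q 0) (E.φ x)) h
  simp only [parCoboundary, AddMonoidHom.coe_mk, ZeroHom.coe_mk, Pi.zero_apply, map_zero,
    mul_zero, map_add, mul_add, map_sum, Finset.mul_sum, map_zsmul, mul_smul_comm,
    α.inducedModule_bracket, α.inducedModule_e] at h'
  rw [← h']
  congr 1
  · rw [E.φ_piMap, E.β_mul, ← mul_assoc, hQ, E.β_comp]
    simp [homogeneous, successiveQuotients]
    rfl
  · refine Finset.sum_congr rfl fun j _ => ?_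
    congr 1
    rw [map_mul, E.φ_unit, E.β_mul, E.β_mul, E.β_comp, partialProd_successiveQuotients,
      mul_inv_cancel_left, ← mul_assoc, ← mul_assoc, hQ, hQ, contractNth_successiveQuotients]
    rfl

theorem homogeneous_translate {n : ℕ} (w : (Fin n → G) → A) (g : G) (e : B)
    (Q : Fin (n + 1) → G) :
    E.β g (E.homogeneous w e Q) = E.homogeneous w (E.β g e) (fun j => g * Q j) := by
  rw [homogeneous, homogeneous, E.β_mul, E.β_comp, successiveQuotients_mul_left]

/-- The component at `e` of the globalization of `w`. -/
noncomputable def component {n : ℕ} (w : (Fin n → G) → A) (g : Fin n → G) (e : B) : B :=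
  E.homogeneous w e fun j => E.anchor e (Fin.partialProd g j)

theorem mul_component {n : ℕ} (w : (Fin n → G) → A) (g : Fin n → G) {e : B}
    (he : IsCentralAtom e) : e * E.component w g e = E.component w g e :=
  he.mul_self_mul _

/-- This is the homogeneous identity on the anchored vertices: anchoring acts vertex by vertex, so
it commutes with deletions, and its equivariance identifies the translated first term. -/
theorem component_cocycle {n : ℕ} {w : (Fin n → G) → A}
    (hw : w ∈ parCocycles α.inducedModule n) (g : Fin (n + 1) → G) {e : B}
    (he : IsCentralAtom e) :
    E.β (g 0) (E.component w (fun i => g i.succ) (E.β (g 0)⁻¹ e)) +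
      ∑ j : Fin (n + 1), (-1 : ℤ) ^ ((j : ℕ) + 1) •
        E.component w (Fin.contractNth j (· * ·) g) e = 0 := by
  rw [← E.homogeneous_cocycle hw e (fun j => E.anchor e (Fin.partialProd g j))
    fun j => E.mul_β_anchor he _]
  congr 1
  · rw [component, homogeneous_translate, E.β_apply_inv]
    congr 1
    funext j
    rw [anchor_translate, Function.comp_apply, Fin.partialProd_succ']
    rfl
  · refine Finset.sum_congr rfl fun j _ => ?_
    rw [component, Fin.partialProd_contractNth]
    rfl

theorem mul_φ_eq_mul_component {n : ℕ} {w : (Fin n → G) → A}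
    (hw : w ∈ parCocycles α.inducedModule n) (g : Fin n → G) {e : B} (he : IsCentralAtom e) :
    e * E.φ (w g) = E.φ (α.unitTuple g) * E.component w g e := by
  have hc := α.isCentralIdempotent_unitTuple g
  have hwg : E.φ (w g) = E.φ (α.unitTuple g) * E.φ (w g) := by
    obtain ⟨m, hm⟩ := hw.1 g
    rw [α.inducedModule_eTuple] at hm
    rw [← map_mul, hm, hc.mul_self_mul]
  rw [← E.mul_component w g he, ← mul_assoc, ← he.comm]
  rcases he.dichotomy _ (E.isCentralIdempotent_φ hc) with h | h
  -- If `e` is orthogonal to `φ(1_{(g₁,…,gₙ)})`, both sides vanish.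
  · rw [h, zero_mul, hwg, ← mul_assoc, h, zero_mul]
  -- Otherwise `e` lies under `φ(1)` and under every `β_{g₁⋯gⱼ}(φ(1))`, so anchoring moves no
  -- vertex.
  · have h1 : e * E.φ 1 = e := by
      conv_rhs => rw [← h, ← mul_one (α.unitTuple g), map_mul, ← mul_assoc, h]
    have hP : (fun j => E.anchor e (Fin.partialProd g j)) = Fin.partialProd g := by
      funext j
      refine E.anchor_eq_self ?_
      refine Fin.cases (by rwa [Fin.partialProd_zero, E.β_one]) (fun i => ?_) j
      have hi : e * E.φ (α.unit (Fin.partialProd g i.succ)) = e := by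
        conv_rhs => rw [← h, ← α.unit_mul_unitTuple g i, ← (α.isCentralIdempotent_unitTuple g).comm,
          map_mul, ← mul_assoc, h]
      rwa [E.φ_unit, ← mul_assoc, h1] at hi
    rw [h, E.mul_component w g he, component, hP, homogeneous, successiveQuotients_partialProd,
      Fin.partialProd_zero, E.β_one]

end EnvelopingAction

/-! ### Assembling the components into a globalization. -/

theorem mainTheorem2 {K G ι B : Type*} [CommRing K] [Group G]
    (A : ι → Type*) [∀ i, Ring (A i)] [∀ i, Algebra K (A i)]
    (hA : ∀ i, IsIndecomposableRing (A i))
    (α : UnitalPartialAction K G (∀ i, A i))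
    [NonUnitalRing B] [Module K B] [IsScalarTower K B B] [SMulCommClass K B B]
    (E : EnvelopingAction α.toPartialAction B)
    (n : ℕ) (w : (Fin n → G) → ∀ i, A i) (hw : w ∈ parCocycles α.inducedModule n) :
    ∃ u : (Fin n → G) → MultiplierAlgebra K B, IsGlobalization α E w u := by
  choose u hu using fun g : Fin n → G =>
    E.exists_multiplier hA (c := E.component w g) fun e he => E.mul_component w g he
  refine ⟨u, (AddMonoidHom.mem_ker).2 (funext fun g => ?_), fun g =>
    E.eq_of_atom_mul_eq hA fun e he => ?_⟩
  -- The component at `e` of a translated element is the translate of its component at `β_{g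
  -- 0}⁻¹(e)`, the atom occurring in `component_cocycle`.
  · have hβ {e : B} (he : IsCentralAtom e) (x : B) :
        e * E.β (g 0) x = E.β (g 0) (E.β (g 0)⁻¹ e * x) := by rw [E.β_mul, E.β_apply_inv]
    refine MultiplierAlgebra.ext_mul (fun b => E.eq_of_atom_mul_eq hA fun e he => ?_)
      (fun b => E.eq_of_atom_mul_eq hA fun e he => ?_)
    · have key := congrArg (b * ·) (E.component_cocycle hw g he)
      simp only [mul_add, Finset.mul_sum, mul_smul_comm, mul_zero] at key
      simp only [usualCoboundary, AddMonoidHom.coe_mk, ZeroHom.coe_mk, Pi.zero_apply, map_zero,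
        mul_zero, map_add, mul_add, map_sum, Finset.mul_sum, map_zsmul, mul_smul_comm]
      rw [← key, E.rightMulHom_betaStar, hβ he, (hu _ _ (E.isCentralAtom_β he _) _).1, E.β_mul,
        E.β_apply_inv]
      exact congrArg _ (Finset.sum_congr rfl fun j _ => congrArg _ (hu _ e he b).1)
    · have key := congrArg (· * b) (E.component_cocycle hw g he)
      simp only [add_mul, Finset.sum_mul, smul_mul_assoc, zero_mul] at key
      simp only [usualCoboundary, AddMonoidHom.coe_mk, ZeroHom.coe_mk, Pi.zero_apply, map_zero,
        mul_zero, map_add, mul_add, map_sum, Finset.mul_sum, map_zsmul, mul_smul_comm]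
      rw [← key, E.leftMulHom_betaStar, hβ he, (hu _ _ (E.isCentralAtom_β he _) _).2, E.β_mul,
        E.β_apply_inv]
      exact congrArg _ (Finset.sum_congr rfl fun j _ => congrArg _ (hu _ e he b).2)
  · rw [(hu g e he _).1, E.mul_φ_eq_mul_component hw g he]
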